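/- Let $A=(a_{ij})$ be an integer $d\times n$ matrix with columns $\mathbf a_1,\dots,\mathbf a_n\in\mathbb Z^d$, and let $\mathbb NA$, $\mathbb ZA$ and $\mathbb R_{\ge 0}A$ be the semigroup, the group and the real cone generated by the columns. Assume that $A$ is pointed, $\mathbb NA\cap(-\mathbb NA)=\{0\}$, and saturated, $\mathbb R_{\ge 0}A\cap\mathbb ZA=\mathbb NA$. Let $\operatorname{Int}(\mathbb NA)$ be the set of elements of $\mathbb NA$ that lie on no proper face of $\mathbb NA$, where a face is the zero locus in $\mathbb NA$ of a linear functional on $\mathbb R^d$ that is nonnegative on $\mathbb NA$. Let $D_A=\mathbb C\langle x_1,\dots,x_n,\partial_1,\dots,\partial_n\rangle$ be the $n$-th Weyl algebra. For $\beta\in\mathbb C^d$ let $H_A(\beta)\subseteq D_A$ be the left ideal generated by all $\partial^{\mathbf s}-\partial^{\mathbf t}$ with $\mathbf s,\mathbf t\in\mathbb N^n$, $A\cdot\mathbf s=A\cdot\mathbf t$, and by $\sum_{j=1}^n a_{ij}x_j\partial_j-\beta_i$ for $i=1,\dots,d$; put $M_A^\beta=D_A/H_A(\beta)$. For $\mathbf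 u\in\mathbb N^n$, right multiplication by $\partial^{\mathbf u}$ induces a $D_A$-linear contiguity map $M_A^{\beta-A\cdot\mathbf u}\to M_A^{\beta}$. (1) Let $\mathbf u,\mathbf v\in\mathbb N^n$, $\mathbf a=A\cdot\mathbf u$ and $\mathbf b=A\cdot\mathbf v$. If $\mathbf b\in\operatorname{Int}(\mathbb NA)$, then the contiguity map $$M_A^{-\mathbf a-\mathbf b}\xrightarrow{\ \cdot\partial^{\mathbf u}\ }M_A^{-\mathbf b}$$ is an isomorphism. (2) For every $\mathbf v\in\mathbb N^n$ with $\mathbf b=A\cdot\mathbf v\in\operatorname{Int}(\mathbb NA)$, the $D_A$-submodule of $M_A^0$ generated by the class of $\partial^{\mathbf v}$ is the image of the contiguity map $M_A^{-\mathbf b}\xrightarrow{\cdot\partial^{\mathbf v}}M_A^0$, and this submodule is the same for all such $\mathbf v$. -/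

import Mathlib

namespace GKZ

/-! ### The Weyl algebra -/

/-- Defining relations of the `n`-th complex Weyl algebra; the generator `Sum.inl j` is the
coordinate `x_j`, the generator `Sum.inr j` is the partial derivative `∂_j`. -/
inductive WeylRel (n : ℕ) :
    FreeAlgebra ℂ (Fin n ⊕ Fin n) → FreeAlgebra ℂ (Fin n ⊕ Fin n) → Prop
  | x_comm (i j : Fin n) :
      WeylRel n (FreeAlgebra.ι ℂ (Sum.inl i) * FreeAlgebra.ι ℂ (Sum.inl j))
        (FreeAlgebra.ι ℂ (Sum.inl j) * FreeAlgebra.ι ℂ (Sum.inl i))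
  | d_comm (i j : Fin n) :
      WeylRel n (FreeAlgebra.ι ℂ (Sum.inr i) * FreeAlgebra.ι ℂ (Sum.inr j))
        (FreeAlgebra.ι ℂ (Sum.inr j) * FreeAlgebra.ι ℂ (Sum.inr i))
  | d_x (i j : Fin n) :
      WeylRel n (FreeAlgebra.ι ℂ (Sum.inr i) * FreeAlgebra.ι ℂ (Sum.inl j))
        (FreeAlgebra.ι ℂ (Sum.inl j) * FreeAlgebra.ι ℂ (Sum.inr i) + if i = j then 1 else 0)

/-- The `n`-th complex Weyl algebra `ℂ⟨x_1, …, x_n, ∂_1, …, ∂_n⟩`. -/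
def WeylAlgebra (n : ℕ) : Type := RingQuot (WeylRel n)

noncomputable instance (n : ℕ) : Ring (WeylAlgebra n) :=
  inferInstanceAs (Ring (RingQuot (WeylRel n)))

noncomputable instance (n : ℕ) : Algebra ℂ (WeylAlgebra n) :=
  inferInstanceAs (Algebra ℂ (RingQuot (WeylRel n)))

/-- The quotient map from the free algebra. -/
noncomputable def weylMk (n : ℕ) : FreeAlgebra ℂ (Fin n ⊕ Fin n) →ₐ[ℂ] WeylAlgebra n :=
  RingQuot.mkAlgHom ℂ (WeylRel n)

theorem weylMk_rel {n : ℕ} {p q : FreeAlgebra ℂ (Fin n ⊕ Fin n)} (h : WeylRel n p q) :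
    weylMk n p = weylMk n q :=
  RingQuot.mkAlgHom_rel ℂ h

/-- The coordinate `x_j`. -/
noncomputable def coord {n : ℕ} (j : Fin n) : WeylAlgebra n :=
  weylMk n (FreeAlgebra.ι ℂ (Sum.inl j))

/-- The partial derivative `∂_j`. -/
noncomputable def del {n : ℕ} (j : Fin n) : WeylAlgebra n :=
  weylMk n (FreeAlgebra.ι ℂ (Sum.inr j))

theorem coord_mul_coord {n : ℕ} (i j : Fin n) : coord i * coord j = coord j * coord i := by
  simpa [coord] using weylMk_rel (WeylRel.x_comm i j)

theorem del_mul_del {n : ℕ} (i j : Fin n) : del i * del j = del j * del i := by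
  simpa [del] using weylMk_rel (WeylRel.d_comm i j)

theorem del_mul_coord {n : ℕ} (i j : Fin n) :
    del i * coord j = coord j * del i + if i = j then 1 else 0 := by
  have h := weylMk_rel (WeylRel.d_x i j)
  split_ifs at h ⊢ <;> simpa [del, coord] using h

/-- The monomial `∂^u = ∂_1^{u_1} ⋯ ∂_n^{u_n}` (the `∂_j` commute with one another). -/
noncomputable def delPow {n : ℕ} (u : Fin n → ℕ) : WeylAlgebra n :=
  ((List.finRange n).map fun j => del j ^ u j).prod

/-! ### The semigroup of an integer matrix -/

/-- The `j`-th column of `A`. -/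
def column {d n : ℕ} (A : Matrix (Fin d) (Fin n) ℤ) (j : Fin n) : Fin d → ℤ := fun i => A i j

/-- The vector `A · u` for `u ∈ ℕ^n`. -/
def deg {d n : ℕ} (A : Matrix (Fin d) (Fin n) ℤ) (u : Fin n → ℕ) : Fin d → ℤ :=
  fun i => ∑ j, A i j * (u j : ℤ)

/-- The semigroup `ℕA`. -/
def semigroup {d n : ℕ} (A : Matrix (Fin d) (Fin n) ℤ) : AddSubmonoid (Fin d → ℤ) :=
  AddSubmonoid.closure (Set.range (column A))

/-- The group `ℤA`. -/
def lattice {d n : ℕ} (A : Matrix (Fin d) (Fin n) ℤ) : AddSubgroup (Fin d → ℤ) :=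
  AddSubgroup.closure (Set.range (column A))

/-- The real cone `ℝ_{≥0}A`. -/
def cone {d n : ℕ} (A : Matrix (Fin d) (Fin n) ℤ) : Set (Fin d → ℝ) :=
  {y | ∃ c : Fin n → ℝ, (∀ j, 0 ≤ c j) ∧ ∀ i, y i = ∑ j, c j * (A i j : ℝ)}

/-- `A` is pointed: `ℕA ∩ (-ℕA) = {0}`. -/
def IsPointed {d n : ℕ} (A : Matrix (Fin d) (Fin n) ℤ) : Prop :=
  ∀ w : Fin d → ℤ, w ∈ semigroup A → -w ∈ semigroup A → w = 0

/-- `A` is saturated: `ℝ_{≥0}A ∩ ℤA = ℕA`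
(which reads `ℝ_{≥0}A ∩ ℤ^d = ℕA` when `ℤA = ℤ^d`). -/
def IsSaturated {d n : ℕ} (A : Matrix (Fin d) (Fin n) ℤ) : Prop :=
  ∀ w : Fin d → ℤ, (w ∈ lattice A ∧ (fun i => (w i : ℝ)) ∈ cone A) ↔ w ∈ semigroup A

/-- `F` is a face of the semigroup `ℕA`: the zero locus on `ℕA` of a linear functional that is
nonnegative on `ℕA`. -/
def IsFace {d n : ℕ} (A : Matrix (Fin d) (Fin n) ℤ) (F : Set (Fin d → ℤ)) : Prop :=
  ∃ φ : (Fin d → ℝ) →ₗ[ℝ] ℝ,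
    (∀ w ∈ semigroup A, 0 ≤ φ fun i => (w i : ℝ)) ∧
      F = {w | w ∈ semigroup A ∧ (φ fun i => (w i : ℝ)) = 0}

/-- The interior `Int(ℕA)`: the elements of `ℕA` that lie on no proper face. -/
def interiorPoints {d n : ℕ} (A : Matrix (Fin d) (Fin n) ℤ) : Set (Fin d → ℤ) :=
  {b | b ∈ semigroup A ∧
    ∀ F : Set (Fin d → ℤ), IsFace A F → F ≠ (semigroup A : Set (Fin d → ℤ)) → b ∉ F}

/-! ### `A`-hypergeometric systems -/

/-- The Euler operator `E_i = ∑_j a_{ij} x_j ∂_j`. -/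
noncomputable def euler {d n : ℕ} (A : Matrix (Fin d) (Fin n) ℤ) (i : Fin d) : WeylAlgebra n :=
  ∑ j, algebraMap ℂ (WeylAlgebra n) (A i j : ℂ) * (coord j * del j)

/-- The left ideal `H_A(β)` generated by the toric operators `∂^s - ∂^t`, `A · s = A · t`,
and by `E_i - β_i` (`Ideal` means left ideal in Mathlib). -/
noncomputable def hyperIdeal {d n : ℕ} (A : Matrix (Fin d) (Fin n) ℤ) (β : Fin d → ℂ) :
    Ideal (WeylAlgebra n) :=
  Ideal.span
    ({P | ∃ s t : Fin n → ℕ, deg A s = deg A t ∧ P = delPow s - delPow t} ∪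
      {P | ∃ i : Fin d, P = euler A i - algebraMap ℂ (WeylAlgebra n) (β i)})

/-- The left module `M_A^β = D_A / H_A(β)`. -/
abbrev HyperModule {d n : ℕ} (A : Matrix (Fin d) (Fin n) ℤ) (β : Fin d → ℂ) : Type :=
  WeylAlgebra n ⧸ hyperIdeal A β

/-- An integer vector as a complex parameter. -/
def param {d : ℕ} (w : Fin d → ℤ) : Fin d → ℂ := fun i => (w i : ℂ)

theorem del_pow_mul_comm {n : ℕ} (i j : Fin n) (k l : ℕ) :
    (del i ^ k * del j ^ l : WeylAlgebra n) = del j ^ l * del i ^ k :=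
  ((show Commute (del i) (del j) from del_mul_del i j).pow_pow k l).eq

theorem delPow_mul_comm {n : ℕ} (u v : Fin n → ℕ) : delPow u * delPow v = delPow v * delPow u := by
  have h : Commute (delPow u) (delPow v) := by
    refine Commute.list_prod_left _ _ fun a ha => Commute.list_prod_right _ _ fun b hb => ?_
    obtain ⟨i, -, rfl⟩ := List.mem_map.1 ha
    obtain ⟨j, -, rfl⟩ := List.mem_map.1 hb
    exact del_pow_mul_comm i j _ _
  exact h.eq

/-- `E_i ∂_k = ∂_k (E_i - a_{ik})`. -/
theorem euler_mul_del {d n : ℕ} (A : Matrix (Fin d) (Fin n) ℤ) (i : Fin d) (k : Fin n) :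
    euler A i * del k =
      del k * (euler A i - algebraMap ℂ (WeylAlgebra n) (A i k : ℂ)) := by
  have h : ∀ j : Fin n, algebraMap ℂ (WeylAlgebra n) (A i j : ℂ) * (coord j * del j) * del k =
      del k * (algebraMap ℂ (WeylAlgebra n) (A i j : ℂ) * (coord j * del j))
        - if k = j then del k * algebraMap ℂ (WeylAlgebra n) (A i k : ℂ) else 0 := by
    intro j
    have e : del k * (algebraMap ℂ (WeylAlgebra n) (A i j : ℂ) * (coord j * del j)) =
        algebraMap ℂ (WeylAlgebra n) (A i j : ℂ) * ((del k * coord j) * del j) := by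
      rw [← mul_assoc, ← Algebra.commutes, mul_assoc, mul_assoc]
    rw [e, del_mul_coord, mul_assoc, mul_assoc, del_mul_del j k]
    split_ifs with hk
    · subst hk
      rw [← Algebra.commutes]
      noncomm_ring
    · noncomm_ring
  rw [euler, Finset.sum_mul, Finset.sum_congr rfl fun j _ => h j, Finset.sum_sub_distrib,
    Finset.sum_ite_eq, mul_sub, Finset.mul_sum]
  simp

/-- `E_i ∂^u = ∂^u (E_i - (A · u)_i)`. -/
theorem euler_mul_delPow {d n : ℕ} (A : Matrix (Fin d) (Fin n) ℤ) (i : Fin d) (u : Fin n → ℕ) :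
    euler A i * delPow u =
      delPow u * (euler A i - algebraMap ℂ (WeylAlgebra n) (param (deg A u) i)) := by
  have step : ∀ (p q : WeylAlgebra n) (r s : ℂ),
      euler A i * p = p * (euler A i - algebraMap ℂ (WeylAlgebra n) r) →
      euler A i * q = q * (euler A i - algebraMap ℂ (WeylAlgebra n) s) →
      euler A i * (p * q) = p * q * (euler A i - algebraMap ℂ (WeylAlgebra n) (r + s)) := by
    intro p q r s hp hq
    rw [← mul_assoc, hp, mul_assoc, sub_mul, hq, Algebra.commutes, map_add]
    noncomm_ring
  have pw : ∀ (k : Fin n) (m : ℕ), euler A i * del k ^ m =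
      del k ^ m * (euler A i - algebraMap ℂ (WeylAlgebra n) ((A i k : ℂ) * m)) := by
    intro k m
    induction m with
    | zero => simp
    | succ m ih =>
      rw [pow_succ, step _ _ _ _ ih (euler_mul_del A i k)]
      congr 3
      push_cast
      ring
  have lst : ∀ l : List (Fin n), euler A i * (l.map fun j => del j ^ u j).prod =
      (l.map fun j => del j ^ u j).prod *
        (euler A i - algebraMap ℂ (WeylAlgebra n) (l.map fun j => (A i j : ℂ) * (u j : ℂ)).sum) := by
    intro l
    induction l with
    | nil => simp
    | cons k l ih =>
      simp only [List.map_cons, List.prod_cons, List.sum_cons]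
      exact step _ _ _ _ (pw k _) ih
  have hs : ((List.finRange n).map fun j => (A i j : ℂ) * (u j : ℂ)).sum = param (deg A u) i := by
    rw [← List.ofFn_eq_map, List.sum_ofFn]
    simp [param, deg]
  rw [delPow, lst, hs]

/-- Right multiplication by `∂^u` sends `H_A(β - A · u)` into `H_A(β)`. -/
theorem hyperIdeal_le_comap {d n : ℕ} (A : Matrix (Fin d) (Fin n) ℤ) (β : Fin d → ℂ)
    (u : Fin n → ℕ) :
    hyperIdeal A (β - param (deg A u)) ≤
      Submodule.comap (LinearMap.toSpanSingleton (WeylAlgebra n) (WeylAlgebra n) (delPow u))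
        (hyperIdeal A β) := by
  refine Submodule.span_le.2 ?_
  rintro P (⟨s, t, hst, rfl⟩ | ⟨i, rfl⟩)
  · have e : (delPow s - delPow t) * delPow u = delPow u * (delPow s - delPow t) := by
      rw [sub_mul, mul_sub, delPow_mul_comm s, delPow_mul_comm t]
    change (delPow s - delPow t) * delPow u ∈ hyperIdeal A β
    rw [e]
    exact Ideal.mul_mem_left _ _ (Ideal.subset_span (Or.inl ⟨s, t, hst, rfl⟩))
  · have e : (euler A i - algebraMap ℂ (WeylAlgebra n) ((β - param (deg A u)) i)) * delPow u =
        delPow u * (euler A i - algebraMap ℂ (WeylAlgebra n) (β i)) := by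
      rw [sub_mul, euler_mul_delPow, Algebra.commutes, ← mul_sub, Pi.sub_apply, map_sub]
      congr 1
      abel
    change (euler A i - algebraMap ℂ (WeylAlgebra n) ((β - param (deg A u)) i)) * delPow u ∈
      hyperIdeal A β
    rw [e]
    exact Ideal.mul_mem_left _ _ (Ideal.subset_span (Or.inr ⟨i, rfl⟩))

/-- The contiguity map `M_A^{β - A·u} → M_A^β`, right multiplication by `∂^u`. -/
noncomputable def contiguityMap {d n : ℕ} (A : Matrix (Fin d) (Fin n) ℤ) (β : Fin d → ℂ)
    (u : Fin n → ℕ) :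
    HyperModule A (β - param (deg A u)) →ₗ[WeylAlgebra n] HyperModule A β :=
  Submodule.mapQ _ _ (LinearMap.toSpanSingleton (WeylAlgebra n) (WeylAlgebra n) (delPow u))
    (hyperIdeal_le_comap A β u)

/-- The contiguity map sends the class of `P` to the class of `P ∂^u`. -/
theorem contiguityMap_mk {d n : ℕ} (A : Matrix (Fin d) (Fin n) ℤ) (β : Fin d → ℂ)
    (u : Fin n → ℕ) (P : WeylAlgebra n) :
    contiguityMap A β u (Submodule.Quotient.mk P) = Submodule.Quotient.mk (P * delPow u) :=
  rfl

/-- The `D_A`-submodule of `M_A^0` generated by the class of `∂^v`. -/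
noncomputable def monomialSubmodule {d n : ℕ} (A : Matrix (Fin d) (Fin n) ℤ) (v : Fin n → ℕ) :
    Submodule (WeylAlgebra n) (HyperModule A 0) :=
  Submodule.span (WeylAlgebra n) {Submodule.Quotient.mk (delPow v)}

end GKZ

/-! The contiguity map is inverted, up to a nonzero scalar, by a right multiplication in the
opposite direction. Let `b` be a polynomial on `ℂ^d` vanishing at the points of `ℕA` outside `A·u +
ℕA`. As a polynomial in `θ_j = x_j ∂_j`, the operator `b(E)` has value `b(A·w)` at `w ∈ ℕ^n`, and
its Newton expansion `∑ c_v x^v ∂^v` inherits the support: `c_v ≠ 0` forces `A·v = A·(z+u)` for some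
`z`. Modulo the toric ideal `∂^v` may then be replaced by `∂^z ∂^u`, so `b(E) ≡ Q ∂^u` with `Q`
homogeneous (`exists_quotient`).

To see that `·Q` maps `M_A^β` back to `M_A^{β-A·u}`, one cancels `∂^u` on the right modulo `D·I_A`
(`mem_toricIdeal_of_mul_delPow`). This is possible because `D/D·I_A` embeds in `ℂ[ℤ^d][x]`, where
`∂_j` acts as `∂/∂x_j + t^{a_j}` and `·∂^u` becomes multiplication by the unit `t^{A·u}`
(`mem_toricIdeal_iff`). Both composites of `·∂^u` and `·Q` are multiplication by `b(β)`, so `b(β) ≠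
0` gives bijectivity.

For saturated `A`, take `b = ∏ (F - m)` over integral functionals `F` defining the cone and `0 ≤ m <
F(A·u)` (`exists_bPolynomial`). At `-b₀` with `b₀` interior, each factor is `-F(b₀) - m < 0`. For
the submodules of `M_A^0`, surjectivity shows that `∂^v` and `∂^{u+v}` generate the same one, and
`∂^{v+v'}` links any two choices. -/

namespace GKZ

/-! ### Polyhedral duality -/

/-- The value of an integral functional at a real vector. -/
def pairing {d : ℕ} (F : Fin d → ℤ) (y : Fin d → ℝ) : ℝ := ∑ i, (F i : ℝ) * y i

theorem pairing_sub_smul {d : ℕ} (F : Fin d → ℤ) (y z : Fin d → ℝ) (t : ℝ) :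
    pairing F (y - t • z) = pairing F y - t * pairing F z := by
  simp only [pairing, Finset.mul_sum, ← Finset.sum_sub_distrib]
  exact Finset.sum_congr rfl fun i _ => by simp; ring

theorem pairing_comb {d : ℕ} (F G : Fin d → ℤ) (k l : ℤ) (y : Fin d → ℝ) :
    pairing (k • F - l • G) y = k * pairing F y - l * pairing G y := by
  simp only [pairing, Finset.mul_sum, ← Finset.sum_sub_distrib]
  exact Finset.sum_congr rfl fun i _ => by simp; ring

theorem pairing_intCast {d : ℕ} (F w : Fin d → ℤ) :
    pairing F (fun i => (w i : ℝ)) = ((∑ i, F i * w i : ℤ) : ℝ) := by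
  simp [pairing]

/-- A finite system of weak affine inequalities in one nonnegative unknown is solvable as soon as
its pairwise eliminations hold. -/
theorem exists_nonneg_of_elimination {ι : Type*} (s : Finset ι) (p q : ι → ℝ)
    (h0 : ∀ k ∈ s, 0 ≤ q k → 0 ≤ p k)
    (h1 : ∀ k ∈ s, ∀ l ∈ s, q k < 0 → 0 < q l → 0 ≤ q l * p k - q k * p l) :
    ∃ t : ℝ, 0 ≤ t ∧ ∀ k ∈ s, 0 ≤ p k - t * q k := by
  classical
  -- The least admissible `t` is the largest lower bound; inserting `0` imposes `t ≥ 0` and makes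
  -- the set nonempty.
  let T : Finset ℝ := insert 0 ((s.filter fun k => q k < 0).image fun k => p k / q k)
  have hT : T.Nonempty := ⟨0, by simp [T]⟩
  refine ⟨T.max' hT, T.le_max' 0 (by simp [T]), fun k hk => ?_⟩
  rcases lt_trichotomy (q k) 0 with hq | hq | hq
  · have hle : p k / q k ≤ T.max' hT := T.le_max' _ (by
      refine Finset.mem_insert_of_mem (Finset.mem_image.2 ⟨k, by simp [hk, hq], rfl⟩))
    rw [div_le_iff_of_neg hq] at hle
    linarith
  · have := h0 k hk hq.ge
    simpa [hq] using this
  · have hle : T.max' hT ≤ p k / q k := by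
      refine T.max'_le hT _ fun y hy => ?_
      rcases Finset.mem_insert.1 hy with rfl | hy
      · exact div_nonneg (h0 k hk hq.le) hq.le
      · obtain ⟨l, hl, rfl⟩ := Finset.mem_image.1 hy
        obtain ⟨hl, hlq⟩ := Finset.mem_filter.1 hl
        have := h1 l hl k hk hlq hq
        rw [le_div_iff₀ hq, div_mul_eq_mul_div, div_le_iff_of_neg hlq]
        linarith
    rw [le_div_iff₀ hq] at hle
    linarith

/-- Fourier–Motzkin elimination: a finitely generated integral cone is cut out by finitely many
integral functionals. -/
theorem exists_functionals_finset {d n : ℕ} (A : Matrix (Fin d) (Fin n) ℤ) (s : Finset (Fin n)) :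
    ∃ S : Finset (Fin d → ℤ), ∀ y : Fin d → ℝ, (∀ F ∈ S, 0 ≤ pairing F y) ↔
      ∃ c : Fin n → ℝ, (∀ j, 0 ≤ c j) ∧ ∀ i, y i = ∑ j ∈ s, c j * (A i j : ℝ) := by
  classical
  induction s using Finset.induction_on with
  | empty =>
    -- The empty cone is `{0}`, cut out by the coordinates and their negatives.
    refine ⟨(Finset.univ.image fun i => Pi.single i 1) ∪ (Finset.univ.image fun i => Pi.single i (-1)),
      fun y => ⟨fun h => ⟨0, fun _ => le_rfl, fun i => ?_⟩, ?_⟩⟩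
    · have h1 := h (Pi.single i 1) (by simp)
      have h2 := h (Pi.single i (-1)) (by simp)
      simp only [pairing, Pi.single_apply] at h1 h2
      simp at h1 h2
      simpa using le_antisymm h2 h1
    · rintro ⟨c, -, hy⟩ F -
      simp [pairing, hy]
  | insert k s hk ih =>
    obtain ⟨S, hS⟩ := ih
    let v (F : Fin d → ℤ) : ℤ := ∑ i, F i * A i k
    have hv (F : Fin d → ℤ) : pairing F (fun i => (A i k : ℝ)) = v F :=
      pairing_intCast F fun i => A i k
    -- Keep the functionals that are nonnegative on the new column, and pair each negative one with
    -- each positive one in the combination that kills the column.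
    refine ⟨(S.filter fun F => 0 ≤ v F) ∪ (((S ×ˢ S).filter fun P => v P.1 < 0 ∧ 0 < v P.2).image
      fun P => v P.2 • P.1 - v P.1 • P.2), fun y => ?_⟩
    have key : (∀ F ∈ (S.filter fun F => 0 ≤ v F) ∪
        (((S ×ˢ S).filter fun P => v P.1 < 0 ∧ 0 < v P.2).image
          fun P => v P.2 • P.1 - v P.1 • P.2), 0 ≤ pairing F y) ↔
        ∃ t : ℝ, 0 ≤ t ∧ ∀ F ∈ S, 0 ≤ pairing F (y - t • fun i => (A i k : ℝ)) := by
      constructor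
      · intro h
        simp only [pairing_sub_smul, hv]
        refine exists_nonneg_of_elimination S (fun F => pairing F y) (fun F => (v F : ℝ))
          (fun F hF hF0 => h F ?_) fun F hF G hG h1 h2 => ?_
        · exact Finset.mem_union_left _ (Finset.mem_filter.2 ⟨hF, by exact_mod_cast hF0⟩)
        · have := h (v G • F - v F • G) (Finset.mem_union_right _ (Finset.mem_image.2 ⟨(F, G),
            Finset.mem_filter.2 ⟨Finset.mem_product.2 ⟨hF, hG⟩, by exact_mod_cast h1,
              by exact_mod_cast h2⟩, rfl⟩))
          rwa [pairing_comb] at this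
      · rintro ⟨t, ht, h⟩ F hF
        simp only [pairing_sub_smul, hv] at h
        rcases Finset.mem_union.1 hF with hF | hF
        · obtain ⟨hF, hF0⟩ := Finset.mem_filter.1 hF
          have h1 := h F hF
          have h2 : (0 : ℝ) ≤ v F := by exact_mod_cast hF0
          nlinarith [mul_nonneg ht h2]
        · obtain ⟨⟨F, G⟩, hFG, rfl⟩ := Finset.mem_image.1 hF
          obtain ⟨hm, h1, h2⟩ := Finset.mem_filter.1 hFG
          obtain ⟨hF, hG⟩ := Finset.mem_product.1 hm
          have h1 : (v F : ℝ) < 0 := by exact_mod_cast h1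
          have h2 : (0 : ℝ) < v G := by exact_mod_cast h2
          rw [pairing_comb]
          nlinarith [mul_nonneg h2.le (h F hF), mul_nonneg (neg_nonneg.2 h1.le) (h G hG)]
    rw [key]
    constructor
    · rintro ⟨t, ht, h⟩
      obtain ⟨c, hc, hy⟩ := (hS _).1 h
      refine ⟨Function.update c k t, fun j => ?_, fun i => ?_⟩
      · rcases eq_or_ne j k with rfl | hj
        · simpa using ht
        · simpa [hj] using hc j
      · rw [Finset.sum_insert hk, Finset.sum_congr rfl fun j hj => by
          rw [Function.update_of_ne (ne_of_mem_of_not_mem hj hk)], ← hy i]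
        simp
    · rintro ⟨c, hc, hy⟩
      refine ⟨c k, hc k, (hS _).2 ⟨c, hc, fun i => ?_⟩⟩
      simp [hy i, Finset.sum_insert hk]

theorem exists_functionals {d n : ℕ} (A : Matrix (Fin d) (Fin n) ℤ) :
    ∃ S : Finset (Fin d → ℤ), ∀ y : Fin d → ℝ, (∀ F ∈ S, 0 ≤ pairing F y) ↔ y ∈ cone A :=
  exists_functionals_finset A Finset.univ

/-! ### Monomials in the Weyl algebra -/

theorem monomial_induction {n : ℕ} {P : (Fin n → ℕ) → Prop} (zero : P 0)
    (add : ∀ w k, P w → P (w + Pi.single k 1)) (w : Fin n → ℕ) : P w := by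
  classical
  induction hm : ∑ j, w j generalizing w with
  | zero =>
    have : w = 0 := funext fun j => by
      simpa using (Finset.sum_eq_zero_iff.1 hm) j (Finset.mem_univ j)
    exact this ▸ zero
  | succ m ih =>
    obtain ⟨k, hk⟩ : ∃ k, w k ≠ 0 := by
      by_contra! h
      simp [h] at hm
    have hw : w = (w - Pi.single k 1) + Pi.single k 1 := funext fun j => by
      rcases eq_or_ne j k with rfl | hj
      · simp; omega
      · simp [hj]
    rw [hw] at hm ⊢
    refine add _ _ (ih _ ?_)
    simpa [Finset.sum_add_distrib] using hm

/-- The ordered product of the powers `g_j ^ u_j`. -/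
def powProd {n : ℕ} {R : Type*} [Monoid R] (g : Fin n → R) (u : Fin n → ℕ) : R :=
  ((List.finRange n).map fun j => g j ^ u j).prod

theorem powProd_zero {n : ℕ} {R : Type*} [Monoid R] (g : Fin n → R) : powProd g 0 = 1 := by
  simp [powProd]

theorem powProd_add {n : ℕ} {R : Type*} [Monoid R] {g : Fin n → R}
    (hg : ∀ i j, Commute (g i) (g j)) (u v : Fin n → ℕ) :
    powProd g (u + v) = powProd g u * powProd g v := by
  have h (l : List (Fin n)) : (l.map fun j => g j ^ (u + v) j).prod =
      (l.map fun j => g j ^ u j).prod * (l.map fun j => g j ^ v j).prod := by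
    induction l with
    | nil => simp
    | cons k l ih =>
      have hc : Commute (g k ^ v k) (l.map fun j => g j ^ u j).prod := by
        refine Commute.list_prod_right _ _ fun a ha => ?_
        obtain ⟨i, -, rfl⟩ := List.mem_map.1 ha
        exact (hg k i).pow_pow _ _
      simp only [List.map_cons, List.prod_cons, ih]
      rw [Pi.add_apply, pow_add, mul_assoc, mul_assoc, ← mul_assoc (g k ^ v k), hc.eq, mul_assoc]
  exact h _

theorem powProd_single {n : ℕ} {R : Type*} [Monoid R] (g : Fin n → R) (k : Fin n) :
    powProd g (Pi.single k 1) = g k := by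
  have h (l : List (Fin n)) : (l.map fun j => g j ^ (Pi.single k 1 : Fin n → ℕ) j).prod =
      g k ^ l.count k := by
    induction l with
    | nil => simp
    | cons i l ih =>
      rcases eq_or_ne i k with rfl | hi
      · simp [ih, pow_succ']
      · simp [ih, hi]
  rw [powProd, h, List.count_eq_one_of_mem (List.nodup_finRange n) (List.mem_finRange k), pow_one]

theorem delPow_zero {n : ℕ} : delPow (0 : Fin n → ℕ) = 1 := powProd_zero _

theorem delPow_add {n : ℕ} (u v : Fin n → ℕ) : delPow (u + v) = delPow u * delPow v :=
  powProd_add del_mul_del u v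

theorem delPow_single {n : ℕ} (k : Fin n) : delPow (Pi.single k 1) = del k := powProd_single _ _

/-- The monomial `x^u`. -/
noncomputable def coordPow {n : ℕ} (u : Fin n → ℕ) : WeylAlgebra n := powProd coord u

theorem coordPow_zero {n : ℕ} : coordPow (0 : Fin n → ℕ) = 1 := powProd_zero _

theorem coordPow_add {n : ℕ} (u v : Fin n → ℕ) : coordPow (u + v) = coordPow u * coordPow v :=
  powProd_add coord_mul_coord u v

theorem coordPow_single {n : ℕ} (k : Fin n) : coordPow (Pi.single k 1) = coord k :=
  powProd_single _ _

theorem coord_mul_coordPow {n : ℕ} (k : Fin n) (u : Fin n → ℕ) :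
    coord k * coordPow u = coordPow (u + Pi.single k 1) := by
  rw [add_comm, coordPow_add, coordPow_single]

theorem del_mul_delPow {n : ℕ} (k : Fin n) (u : Fin n → ℕ) :
    del k * delPow u = delPow (u + Pi.single k 1) := by
  rw [add_comm, delPow_add, delPow_single]

/-- The normally ordered monomials `x^v ∂^w`. -/
noncomputable def normalMonomial {n : ℕ} (p : (Fin n → ℕ) × (Fin n → ℕ)) : WeylAlgebra n :=
  coordPow p.1 * delPow p.2

/-- Stability of `S` under left multiplication by `p` passes to sums and products in `p`, so it
extends from the generators to the whole algebra. -/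
theorem weyl_left_induction {n : ℕ} {S : Submodule ℂ (WeylAlgebra n)} (one : 1 ∈ S)
    (coord_mul : ∀ j, ∀ P ∈ S, coord j * P ∈ S) (del_mul : ∀ j, ∀ P ∈ S, del j * P ∈ S)
    (P : WeylAlgebra n) : P ∈ S := by
  obtain ⟨p, rfl⟩ : ∃ p, weylMk n p = P := RingQuot.mkAlgHom_surjective ℂ (WeylRel n) P
  have h : ∀ Q ∈ S, weylMk n p * Q ∈ S := by
    induction p using FreeAlgebra.induction with
    | grade0 r =>
      intro Q hQ
      rw [AlgHom.commutes, ← Algebra.smul_def]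
      exact S.smul_mem r hQ
    | grade1 x =>
      rcases x with j | j
      · exact coord_mul j
      · exact del_mul j
    | mul a b ha hb =>
      intro Q hQ
      rw [map_mul, mul_assoc]
      exact ha _ (hb _ hQ)
    | add a b ha hb =>
      intro Q hQ
      rw [map_add, add_mul]
      exact S.add_mem (ha _ hQ) (hb _ hQ)
  simpa using h 1 one

/-- Only spanning is needed: independence plays no role in computing the kernel of `toricSymbol`. -/
theorem span_normalMonomial {n : ℕ} :
    Submodule.span ℂ (Set.range (normalMonomial (n := n))) = ⊤ := by
  set S := Submodule.span ℂ (Set.range (normalMonomial (n := n))) with hS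
  have of_mono {j : Fin n} {g : WeylAlgebra n} (h : ∀ v w, g * normalMonomial (v, w) ∈ S) :
      ∀ P ∈ S, g * P ∈ S := by
    intro P hP
    induction hP using Submodule.span_induction with
    | mem P hP => obtain ⟨⟨v, w⟩, rfl⟩ := hP; exact h v w
    | zero => simp
    | add P Q _ _ hP hQ => rw [mul_add]; exact S.add_mem hP hQ
    | smul c P _ hP => rw [mul_smul_comm]; exact S.smul_mem c hP
  have mono (v w : Fin n → ℕ) : coordPow v * delPow w ∈ S := Submodule.subset_span ⟨(v, w), rfl⟩
  have hx (j : Fin n) : ∀ P ∈ S, coord j * P ∈ S := of_mono (j := j) fun v w => by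
    rw [normalMonomial, ← mul_assoc, coord_mul_coordPow]
    exact mono _ _
  have hd (j : Fin n) : ∀ P ∈ S, del j * P ∈ S := of_mono (j := j) fun v w => by
    -- Normal ordering: `∂_j` moves past one variable `x_k` at a time, each time leaving a
    -- correction `δ_{jk}`.
    induction v using monomial_induction with
    | zero =>
      rw [normalMonomial, coordPow_zero, one_mul, del_mul_delPow]
      simpa [coordPow_zero] using mono 0 (w + Pi.single j 1)
    | add v k ih =>
      rw [normalMonomial, ← coord_mul_coordPow, ← mul_assoc, ← mul_assoc, del_mul_coord,
        add_mul, add_mul]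
      refine S.add_mem ?_ ?_
      · simpa [mul_assoc, normalMonomial] using hx k _ ih
      · split_ifs
        · simpa using mono v w
        · simp
  refine eq_top_iff.2 fun P _ => weyl_left_induction ?_ hx hd P
  simpa [coordPow_zero, delPow_zero] using mono 0 0

/-! ### The toric module -/

theorem deg_add {d n : ℕ} (A : Matrix (Fin d) (Fin n) ℤ) (u v : Fin n → ℕ) :
    deg A (u + v) = deg A u + deg A v := by
  ext i
  simp [deg, mul_add, Finset.sum_add_distrib]

theorem deg_single {d n : ℕ} (A : Matrix (Fin d) (Fin n) ℤ) (k : Fin n) :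
    deg A (Pi.single k 1) = column A k := by
  ext i
  simp [deg, column, Pi.single_apply]

theorem deg_zero {d n : ℕ} (A : Matrix (Fin d) (Fin n) ℤ) : deg A 0 = 0 := by
  ext i
  simp [deg]

/-- The left ideal `D · I_A` generated by the toric operators. -/
noncomputable def toricIdeal {d n : ℕ} (A : Matrix (Fin d) (Fin n) ℤ) : Ideal (WeylAlgebra n) :=
  Ideal.span {P | ∃ s t : Fin n → ℕ, deg A s = deg A t ∧ P = delPow s - delPow t}

theorem delPow_sub_mem_toricIdeal {d n : ℕ} {A : Matrix (Fin d) (Fin n) ℤ} {s t : Fin n → ℕ}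
    (h : deg A s = deg A t) : delPow s - delPow t ∈ toricIdeal A :=
  Ideal.subset_span ⟨s, t, h, rfl⟩

/-- The group algebra `ℂ[ℤ^d]`. -/
abbrev LaurentRing (d : ℕ) : Type := AddMonoidAlgebra ℂ (Fin d → ℤ)

/-- The module `ℂ[ℤ^d][x_1, …, x_n]`. -/
abbrev ToricModule (d n : ℕ) : Type := MvPolynomial (Fin n) (LaurentRing d)

/-- The operator by which `∂_j` acts on `ToricModule d n`. -/
noncomputable def toricDel {d n : ℕ} (A : Matrix (Fin d) (Fin n) ℤ) (j : Fin n) :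
    Module.End (LaurentRing d) (ToricModule d n) :=
  (MvPolynomial.pderiv j).toLinearMap + AddMonoidAlgebra.single (column A j) (1 : ℂ) • 1

/-- The commutator of two derivations is a derivation, and this one kills every variable. -/
theorem pderiv_comm {σ R : Type*} [CommRing R] (i j : σ) (f : MvPolynomial σ R) :
    MvPolynomial.pderiv i (MvPolynomial.pderiv j f) =
      MvPolynomial.pderiv j (MvPolynomial.pderiv i f) := by
  classical
  have h : ⁅MvPolynomial.pderiv (R := R) i, MvPolynomial.pderiv j⁆ = 0 :=
    MvPolynomial.derivation_ext fun k => by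
      rw [Derivation.commutator_apply]
      simp [MvPolynomial.pderiv_X, Pi.single_apply, apply_ite]
  have := DFunLike.congr_fun h f
  rwa [Derivation.commutator_apply, Derivation.zero_apply, sub_eq_zero] at this

/-- The action of the Weyl algebra on `ToricModule d n`: `x_j` acts by multiplication and `∂_j` by
`∂/∂x_j + t^{a_j}`. -/
noncomputable def toricAction {d n : ℕ} (A : Matrix (Fin d) (Fin n) ℤ) :
    WeylAlgebra n →ₐ[ℂ] Module.End (LaurentRing d) (ToricModule d n) :=
  RingQuot.liftAlgHom ℂ ⟨FreeAlgebra.lift ℂ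
    (Sum.elim (fun j => LinearMap.mulLeft _ (MvPolynomial.X j)) (toricDel A)), by
    intro p q h
    induction h with
    | x_comm i j =>
      refine LinearMap.ext fun f => ?_
      simp [mul_left_comm]
    | d_comm i j =>
      refine LinearMap.ext fun f => ?_
      simp [toricDel, smul_smul, AddMonoidAlgebra.single_mul_single, add_comm, pderiv_comm i j f]
      abel
    | d_x i j =>
      refine LinearMap.ext fun f => ?_
      have h : (MvPolynomial.pderiv i (MvPolynomial.X j) : ToricModule d n) =
          if i = j then 1 else 0 := by
        classical
        rw [MvPolynomial.pderiv_X, Pi.single_apply]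
        simp only [eq_comm]
      split_ifs at h ⊢
      · simp [toricDel, h, mul_add]
        abel
      · simp [toricDel, h, mul_add]⟩

theorem toricAction_coord {d n : ℕ} (A : Matrix (Fin d) (Fin n) ℤ) (j : Fin n)
    (f : ToricModule d n) : toricAction A (coord j) f = MvPolynomial.X j * f := by
  have : toricAction A (coord j) = LinearMap.mulLeft _ (MvPolynomial.X j) := by
    refine (RingQuot.liftAlgHom_mkAlgHom_apply _ _ _ _).trans ?_
    simp
  rw [this]; rfl

theorem toricAction_del {d n : ℕ} (A : Matrix (Fin d) (Fin n) ℤ) (j : Fin n) :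
    toricAction A (del j) = toricDel A j := by
  refine (RingQuot.liftAlgHom_mkAlgHom_apply _ _ _ _).trans ?_
  simp

theorem toricAction_delPow_one {d n : ℕ} (A : Matrix (Fin d) (Fin n) ℤ) (u : Fin n → ℕ) :
    toricAction A (delPow u) 1 =
      AddMonoidAlgebra.single (deg A u) (1 : ℂ) • (1 : ToricModule d n) := by
  induction u using monomial_induction with
  | zero => simp [delPow_zero, deg_zero, ← AddMonoidAlgebra.one_def]
  | add u k ih =>
    rw [← del_mul_delPow, map_mul, Module.End.mul_apply, ih, map_smul, toricAction_del]
    simp [toricDel, smul_smul, AddMonoidAlgebra.single_mul_single, deg_add, deg_single]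

theorem toricAction_coordPow {d n : ℕ} (A : Matrix (Fin d) (Fin n) ℤ) (u : Fin n → ℕ)
    (f : ToricModule d n) : toricAction A (coordPow u) f =
      MvPolynomial.monomial (Finsupp.equivFunOnFinite.symm u) 1 * f := by
  induction u using monomial_induction with
  | zero =>
    have : Finsupp.equivFunOnFinite.symm (0 : Fin n → ℕ) = 0 := by ext; simp
    simp [coordPow_zero, this]
  | add u k ih =>
    have : Finsupp.equivFunOnFinite.symm (u + Pi.single k 1) =
        Finsupp.single k 1 + Finsupp.equivFunOnFinite.symm u := by
      classical
      ext j; simp [add_comm, Finsupp.single_apply, Pi.single_apply, eq_comm]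
    rw [← coord_mul_coordPow, map_mul, Module.End.mul_apply, ih, toricAction_coord, this,
      MvPolynomial.X, ← mul_assoc, MvPolynomial.monomial_mul, mul_one]

/-- The image of `1` under an operator. -/
noncomputable def toricSymbol {d n : ℕ} (A : Matrix (Fin d) (Fin n) ℤ) :
    WeylAlgebra n →ₗ[ℂ] ToricModule d n :=
  (LinearMap.applyₗ' ℂ (1 : ToricModule d n)).comp (toricAction A).toLinearMap

theorem toricSymbol_apply {d n : ℕ} (A : Matrix (Fin d) (Fin n) ℤ) (P : WeylAlgebra n) :
    toricSymbol A P = toricAction A P 1 := rfl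

/-- The Weyl algebra acts `ℂ[ℤ^d]`-linearly, so the scalar `t^{A·u} = ∂^u · 1` comes out in front.
-/
theorem toricSymbol_mul_delPow {d n : ℕ} (A : Matrix (Fin d) (Fin n) ℤ) (P : WeylAlgebra n)
    (u : Fin n → ℕ) : toricSymbol A (P * delPow u) =
      AddMonoidAlgebra.single (deg A u) (1 : ℂ) • toricSymbol A P := by
  rw [toricSymbol_apply, map_mul, Module.End.mul_apply, toricAction_delPow_one, map_smul,
    toricSymbol_apply]

/-- The symbol of `x^v ∂^w` is `t^{A·w} x^v`, which determines the class of `x^v ∂^w` modulo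
`D·I_A`; hence the quotient map factors through the symbol. -/
theorem mem_toricIdeal_iff {d n : ℕ} (A : Matrix (Fin d) (Fin n) ℤ) (P : WeylAlgebra n) :
    P ∈ toricIdeal A ↔ toricSymbol A P = 0 := by
  classical
  constructor
  · intro h
    induction h using Submodule.span_induction with
    | mem P hP =>
      obtain ⟨s, t, hst, rfl⟩ := hP
      rw [map_sub, toricSymbol_apply, toricSymbol_apply, toricAction_delPow_one,
        toricAction_delPow_one, hst, sub_self]
    | zero => exact map_zero _
    | add P Q _ _ hP hQ => rw [map_add, hP, hQ, add_zero]
    | smul a P _ hP =>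
      rw [toricSymbol_apply] at hP ⊢
      rw [smul_eq_mul, map_mul, Module.End.mul_apply, hP, map_zero]
  · let B := (AddMonoidAlgebra.basis (Fin d → ℤ) ℂ).smulTower
      (MvPolynomial.basisMonomials (Fin n) (LaurentRing d))
    -- `τ` sends the basis vector `t^a x^v` to the class of `x^v ∂^w` for a chosen `w` with `A·w =
    -- a`. The value `0` for `a ∉ ℕA` is immaterial, since no such `t^a` occurs in a symbol.
    let τ : ToricModule d n →ₗ[ℂ] WeylAlgebra n ⧸ toricIdeal A := B.constr ℂ fun p =>
      Submodule.Quotient.mk (coordPow (p.2 : Fin n → ℕ) *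
        if h : ∃ w, deg A w = p.1 then delPow h.choose else 0)
    have hτ : τ ∘ₗ toricSymbol A = (toricIdeal A).mkQ.restrictScalars ℂ := by
      refine LinearMap.ext_on_range span_normalMonomial fun ⟨v, w⟩ => ?_
      have h1 : toricSymbol A (normalMonomial (v, w)) =
          B (deg A w, Finsupp.equivFunOnFinite.symm v) := by
        rw [toricSymbol_apply, normalMonomial, map_mul, Module.End.mul_apply,
          toricAction_delPow_one, map_smul, toricAction_coordPow]
        simp [B, Module.Basis.smulTower_apply, AddMonoidAlgebra.basis]
      have h : ∃ w', deg A w' = deg A w := ⟨w, rfl⟩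
      rw [LinearMap.comp_apply, h1, Module.Basis.constr_basis, dif_pos h]
      refine (Submodule.Quotient.eq _).2 ?_
      change coordPow v * _ - coordPow v * _ ∈ _
      rw [← mul_sub]
      exact Ideal.mul_mem_left _ _ (delPow_sub_mem_toricIdeal h.choose_spec)
    intro h
    have := LinearMap.congr_fun hτ P
    rw [LinearMap.comp_apply, h, map_zero] at this
    exact (Submodule.Quotient.mk_eq_zero _).1 this.symm

/-- Right multiplication by `∂^u` is injective on `D / D · I_A`. -/
theorem mem_toricIdeal_of_mul_delPow {d n : ℕ} {A : Matrix (Fin d) (Fin n) ℤ} {P : WeylAlgebra n}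
    {u : Fin n → ℕ} (h : P * delPow u ∈ toricIdeal A) : P ∈ toricIdeal A := by
  rw [mem_toricIdeal_iff, toricSymbol_mul_delPow] at h
  rw [mem_toricIdeal_iff]
  -- Exponents range over `ℤ^d` rather than `ℕA`, so `t^{A·u}` is invertible.
  have := congrArg (AddMonoidAlgebra.single (-deg A u) (1 : ℂ) • ·) h
  simpa [smul_smul, AddMonoidAlgebra.single_mul_single, ← AddMonoidAlgebra.one_def] using this

/-! ### Polynomials in the Euler operators -/

theorem euler_mul_coordPow {d n : ℕ} (A : Matrix (Fin d) (Fin n) ℤ) (i : Fin d) (u : Fin n → ℕ) :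
    euler A i * coordPow u =
      coordPow u * (euler A i + algebraMap ℂ (WeylAlgebra n) (deg A u i : ℂ)) := by
  have hk (k : Fin n) : euler A i * coord k = coord k * (euler A i + algebraMap ℂ _ (A i k : ℂ)) := by
    have h (j : Fin n) : algebraMap ℂ (WeylAlgebra n) (A i j : ℂ) * (coord j * del j) * coord k =
        coord k * (algebraMap ℂ (WeylAlgebra n) (A i j : ℂ) * (coord j * del j)) +
          if j = k then coord k * algebraMap ℂ (WeylAlgebra n) (A i k : ℂ) else 0 := by
      rw [mul_assoc, mul_assoc (coord j), del_mul_coord, ← mul_assoc (coord k), ← Algebra.commutes,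
        mul_assoc _ (coord k), ← mul_assoc (coord k), coord_mul_coord k j, mul_add, mul_add,
        mul_assoc (coord j)]
      split_ifs with hjk
      · subst hjk
        rw [mul_one, Algebra.commutes _ (coord j)]
      · simp
    rw [euler, Finset.sum_mul, Finset.sum_congr rfl fun j _ => h j, Finset.sum_add_distrib,
      Finset.sum_ite_eq', mul_add, Finset.mul_sum]
    simp
  induction u using monomial_induction with
  | zero => simp [coordPow_zero, deg_zero]
  | add u k ih =>
    rw [← coord_mul_coordPow, ← mul_assoc, hk, mul_assoc, add_mul, ih, mul_assoc, deg_add,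
      deg_single, Algebra.commutes]
    simp only [column, Pi.add_apply, Int.cast_add, map_add]
    noncomm_ring

/-- `E_i x^v ∂^w = x^v ∂^w (E_i + (A · v - A · w)_i)`. -/
theorem euler_mul_normalMonomial {d n : ℕ} (A : Matrix (Fin d) (Fin n) ℤ) (i : Fin d)
    (v w : Fin n → ℕ) : euler A i * (coordPow v * delPow w) = coordPow v * delPow w *
      (euler A i + algebraMap ℂ (WeylAlgebra n) ((deg A v i : ℂ) - deg A w i)) := by
  rw [← mul_assoc, euler_mul_coordPow, mul_assoc, add_mul, euler_mul_delPow, Algebra.commutes,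
    mul_assoc, map_sub]
  simp only [param]
  noncomm_ring

/-- This matches the recursion `mul_fallingFactorial`; hence `x^v ∂^v` behaves as the polynomial
`[θ]_v`. -/
theorem theta_mul_normalMonomial {n : ℕ} (j : Fin n) (w : Fin n → ℕ) :
    coord j * del j * (coordPow w * delPow w) =
      coordPow (w + Pi.single j 1) * delPow (w + Pi.single j 1) +
        (w j : ℂ) • (coordPow w * delPow w) := by
  have h : coord j * del j * coordPow w =
      coordPow w * (coord j * del j) + (w j : ℂ) • coordPow w := by
    -- `θ_j` is the Euler operator of the one-row matrix with entry `1` in column `j` and `0`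
    -- elsewhere.
    have := euler_mul_coordPow (fun (_ : Fin 1) k => if k = j then 1 else 0) 0 w
    simpa [euler, deg, mul_add, ← (Nat.cast_commute (w j) (coordPow w)).eq,
      Algebra.smul_def] using this
  rw [← mul_assoc, h, add_mul, smul_mul_assoc, mul_assoc, mul_assoc (coord j), del_mul_delPow,
    ← mul_assoc, coordPow_add, coordPow_single]

/-! ### Falling factorials and Newton expansions -/

/-- The falling factorial `[w]_v = ∏_j w_j (w_j - 1) ⋯ (w_j - v_j + 1)`. -/
def fallingFactorial {n : ℕ} (v w : Fin n → ℕ) : ℕ := ∏ j, (w j).descFactorial (v j)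

theorem fallingFactorial_zero {n : ℕ} (w : Fin n → ℕ) : fallingFactorial 0 w = 1 := by
  simp [fallingFactorial]

theorem fallingFactorial_self_ne_zero {n : ℕ} (w : Fin n → ℕ) : fallingFactorial w w ≠ 0 :=
  Finset.prod_ne_zero_iff.2 fun j _ => by simp [Nat.descFactorial_self, Nat.factorial_ne_zero]

theorem fallingFactorial_eq_zero {n : ℕ} {v w : Fin n → ℕ} (h : ¬ v ≤ w) :
    fallingFactorial v w = 0 := by
  obtain ⟨j, hj⟩ := not_forall.1 h
  exact Finset.prod_eq_zero (Finset.mem_univ j) (Nat.descFactorial_of_lt (not_le.1 hj))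

theorem mul_fallingFactorial {n : ℕ} (v w : Fin n → ℕ) (j : Fin n) :
    (w j : ℂ) * fallingFactorial v w =
      fallingFactorial (v + Pi.single j 1) w + v j * fallingFactorial v w := by
  have h (u : Fin n → ℕ) : fallingFactorial u w =
      (w j).descFactorial (u j) * ∏ k ∈ Finset.univ.erase j, (w k).descFactorial (u k) :=
    (Finset.mul_prod_erase _ _ (Finset.mem_univ j)).symm
  have h2 : ∏ k ∈ Finset.univ.erase j, (w k).descFactorial ((v + Pi.single j 1 : Fin n → ℕ) k) =
      ∏ k ∈ Finset.univ.erase j, (w k).descFactorial (v k) :=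
    Finset.prod_congr rfl fun k hk => by simp [Finset.ne_of_mem_erase hk]
  rw [h, h (v + _), h2]
  simp only [Pi.add_apply, Pi.single_eq_same, Nat.descFactorial_succ, Nat.cast_mul]
  rcases le_or_gt (v j) (w j) with hle | hlt
  · rw [Nat.cast_sub hle]; ring
  · simp [Nat.descFactorial_of_lt hlt]

/-- `R` is the polynomial in `θ_1, …, θ_n` with values `f`: the operator `∑ c_v x^v ∂^v`, where
`f(w) = ∑ c_v [w]_v`. -/
def HasNewtonExpansion {n : ℕ} (R : WeylAlgebra n) (f : (Fin n → ℕ) → ℂ) : Prop :=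
  ∃ c : (Fin n → ℕ) →₀ ℂ, R = c.sum (fun v r => r • (coordPow v * delPow v)) ∧
    ∀ w, f w = c.sum fun v r => r * fallingFactorial v w

namespace HasNewtonExpansion

variable {n : ℕ} {R S : WeylAlgebra n} {f g : (Fin n → ℕ) → ℂ}

theorem one : HasNewtonExpansion (1 : WeylAlgebra n) 1 :=
  ⟨Finsupp.single 0 1, by simp [coordPow_zero, delPow_zero], by simp [fallingFactorial_zero]⟩

theorem zero : HasNewtonExpansion (0 : WeylAlgebra n) 0 := ⟨0, by simp, by simp⟩

theorem add (hR : HasNewtonExpansion R f) (hS : HasNewtonExpansion S g) :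
    HasNewtonExpansion (R + S) (f + g) := by
  obtain ⟨c, rfl, hc⟩ := hR
  obtain ⟨e, rfl, he⟩ := hS
  refine ⟨c + e, ?_, fun w => ?_⟩
  · rw [Finsupp.sum_add_index'] <;> simp [add_smul]
  · rw [Pi.add_apply, hc, he, Finsupp.sum_add_index'] <;> simp [add_mul]

theorem smul (r : ℂ) (hR : HasNewtonExpansion R f) : HasNewtonExpansion (r • R) (r • f) := by
  obtain ⟨c, rfl, hc⟩ := hR
  refine ⟨r • c, ?_, fun w => ?_⟩
  · rw [Finsupp.sum_smul_index' (by simp), Finsupp.smul_sum]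
    simp [smul_smul]
  · rw [Pi.smul_apply, hc, Finsupp.sum_smul_index' (by simp), Finsupp.smul_sum]
    simp [mul_assoc]

theorem sum {ι : Type*} (s : Finset ι) {R : ι → WeylAlgebra n} {f : ι → (Fin n → ℕ) → ℂ}
    (h : ∀ i ∈ s, HasNewtonExpansion (R i) (f i)) :
    HasNewtonExpansion (∑ i ∈ s, R i) (∑ i ∈ s, f i) := by
  classical
  induction s using Finset.induction_on with
  | empty => simpa using zero
  | insert k s hk ih =>
    rw [Finset.sum_insert hk, Finset.sum_insert hk]
    exact (h k (Finset.mem_insert_self _ _)).add (ih fun i hi => h i (Finset.mem_insert_of_mem hi))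

theorem monomial (v : Fin n → ℕ) :
    HasNewtonExpansion (coordPow v * delPow v) (fun w => fallingFactorial v w) :=
  ⟨Finsupp.single v 1, by simp, by simp⟩

theorem theta_mul (j : Fin n) (hR : HasNewtonExpansion R f) :
    HasNewtonExpansion (coord j * del j * R) (fun w => w j * f w) := by
  obtain ⟨c, rfl, hc⟩ := hR
  have : (fun w => w j * f w) = ∑ v ∈ c.support, c v • ((fun w : Fin n → ℕ =>
      (fallingFactorial (v + Pi.single j 1) w : ℂ)) + (v j : ℂ) • fun w =>
        (fallingFactorial v w : ℂ)) := by
    ext w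
    simp only [hc, Finsupp.sum, Finset.mul_sum, Finset.sum_apply, Pi.smul_apply, Pi.add_apply,
      smul_eq_mul]
    refine Finset.sum_congr rfl fun v _ => ?_
    rw [← mul_fallingFactorial]; ring
  rw [this, Finsupp.sum, Finset.mul_sum]
  refine sum _ fun v _ => ?_
  rw [mul_smul_comm, theta_mul_normalMonomial]
  exact ((monomial _).add ((monomial v).smul _)).smul _

theorem euler_mul {d : ℕ} (A : Matrix (Fin d) (Fin n) ℤ) (i : Fin d)
    (hR : HasNewtonExpansion R f) :
    HasNewtonExpansion (euler A i * R) (fun w => deg A w i * f w) := by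
  have : (fun w => (deg A w i : ℂ) * f w) =
      ∑ j, (A i j : ℂ) • fun w : Fin n → ℕ => (w j : ℂ) * f w := by
    ext w
    simp [deg, Finset.sum_mul, mul_assoc]
  rw [this, euler, Finset.sum_mul]
  refine sum _ fun j _ => ?_
  rw [← Algebra.smul_def, smul_mul_assoc]
  exact (hR.theta_mul j).smul _

/-- The Newton expansion of a function that vanishes off an upper set is supported on it. -/
theorem exists_support_subset (hR : HasNewtonExpansion R f) {M : Set (Fin n → ℕ)}
    (hM : IsUpperSet M) (hf : ∀ w ∉ M, f w = 0) :
    ∃ c : (Fin n → ℕ) →₀ ℂ, R = c.sum (fun v r => r • (coordPow v * delPow v)) ∧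
      ∀ v ∈ c.support, v ∈ M := by
  obtain ⟨c, hR, hc⟩ := hR
  refine ⟨c, hR, ?_⟩
  suffices h : ∀ w ∉ M, c w = 0 from fun v hv => by
    by_contra hvM
    exact Finsupp.mem_support_iff.1 hv (h v hvM)
  intro w
  -- At `w ∉ M`, terms with `v < w` vanish by induction (`v ∉ M` as `M` is an upper set) and terms
  -- with `v ≰ w` vanish because `[w]_v = 0`. What remains is `c_w [w]_w = 0`, and `[w]_w ≠ 0`.
  induction w using WellFoundedLT.induction with
  | ind w ih =>
    intro hw
    have h := hf w hw
    rw [hc, Finsupp.sum, Finset.sum_eq_single w] at h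
    · exact (mul_eq_zero.1 h).resolve_right (Nat.cast_ne_zero.2 (fallingFactorial_self_ne_zero w))
    · intro v _ hvw
      by_cases hle : v ≤ w
      · rw [ih v (lt_of_le_of_ne hle hvw) fun hv => hw (hM hle hv), zero_mul]
      · rw [fallingFactorial_eq_zero hle, Nat.cast_zero, mul_zero]
    · intro hw'
      rw [Finsupp.notMem_support_iff.1 hw', zero_mul]

end HasNewtonExpansion

/-! ### Products of affine forms in the Euler operators -/

/-- The linear form `∑ F_i s_i`. -/
def linForm {d : ℕ} (F : Fin d → ℤ) (s : Fin d → ℂ) : ℂ := ∑ i, (F i : ℂ) * s i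

theorem linForm_add {d : ℕ} (F : Fin d → ℤ) (s t : Fin d → ℂ) :
    linForm F (s + t) = linForm F s + linForm F t := by
  simp [linForm, mul_add, Finset.sum_add_distrib]

theorem linForm_param {d : ℕ} (F w : Fin d → ℤ) :
    linForm F (param w) = ((∑ i, F i * w i : ℤ) : ℂ) := by
  simp [linForm, param]

/-- The factor `F(E + s) - m`. -/
noncomputable def eulerFactor {d n : ℕ} (A : Matrix (Fin d) (Fin n) ℤ) (s : Fin d → ℂ)
    (p : (Fin d → ℤ) × ℕ) : WeylAlgebra n :=
  ∑ i, algebraMap ℂ _ (p.1 i : ℂ) * euler A i +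
    algebraMap ℂ (WeylAlgebra n) (linForm p.1 s - p.2)

/-- The operator `b(E + s)`, where `b` is the product of the `F - m` over the list. -/
noncomputable def eulerProd {d n : ℕ} (A : Matrix (Fin d) (Fin n) ℤ)
    (l : List ((Fin d → ℤ) × ℕ)) (s : Fin d → ℂ) : WeylAlgebra n :=
  (l.map (eulerFactor A s)).prod

/-- The number `b(s)`. -/
def scalarProd {d : ℕ} (l : List ((Fin d → ℤ) × ℕ)) (s : Fin d → ℂ) : ℂ :=
  (l.map fun p => linForm p.1 s - p.2).prod

theorem hasNewtonExpansion_eulerProd {d n : ℕ} (A : Matrix (Fin d) (Fin n) ℤ)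
    (l : List ((Fin d → ℤ) × ℕ)) :
    HasNewtonExpansion (eulerProd A l 0) fun w => scalarProd l (param (deg A w)) := by
  induction l with
  | nil => exact HasNewtonExpansion.one
  | cons p l ih =>
    have h : (fun w => scalarProd (p :: l) (param (deg A w))) =
        (∑ i, (p.1 i : ℂ) • fun w : Fin n → ℕ =>
          (deg A w i : ℂ) * scalarProd l (param (deg A w))) +
          (-(p.2 : ℂ)) • fun w => scalarProd l (param (deg A w)) := by
      ext w
      simp [scalarProd, linForm, param, sub_eq_add_neg, add_mul, Finset.sum_mul, mul_assoc]
    have h' : eulerProd A (p :: l) 0 = ∑ i, (p.1 i : ℂ) • (euler A i * eulerProd A l 0) +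
        (-(p.2 : ℂ)) • eulerProd A l 0 := by
      simp [eulerProd, eulerFactor, linForm, add_mul, Finset.sum_mul, Algebra.smul_def, mul_assoc]
    rw [h, h']
    exact (HasNewtonExpansion.sum _ fun i _ => (ih.euler_mul A i).smul _).add (ih.smul _)

/-- `b(E + s) ∂^u = ∂^u b(E + s - A · u)`. -/
theorem eulerProd_mul_delPow {d n : ℕ} (A : Matrix (Fin d) (Fin n) ℤ)
    (l : List ((Fin d → ℤ) × ℕ)) (s : Fin d → ℂ) (u : Fin n → ℕ) :
    eulerProd A l (s + param (deg A u)) * delPow u = delPow u * eulerProd A l s := by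
  have h (p : (Fin d → ℤ) × ℕ) : eulerFactor A (s + param (deg A u)) p * delPow u =
      delPow u * eulerFactor A s p := by
    have h1 (i : Fin d) : algebraMap ℂ (WeylAlgebra n) (p.1 i : ℂ) * euler A i * delPow u =
        delPow u * (algebraMap ℂ _ (p.1 i : ℂ) * euler A i) -
          delPow u * algebraMap ℂ _ ((p.1 i : ℂ) * param (deg A u) i) := by
      rw [mul_assoc, euler_mul_delPow, ← mul_assoc, Algebra.commutes, mul_assoc, mul_sub, mul_sub,
        map_mul]
    rw [eulerFactor, add_mul, Finset.sum_mul, Finset.sum_congr rfl fun i _ => h1 i,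
      Finset.sum_sub_distrib, ← Finset.mul_sum, ← Finset.mul_sum, ← map_sum, Algebra.commutes,
      eulerFactor, linForm_add, mul_add, add_sub_right_comm, map_add]
    simp only [linForm]
    noncomm_ring
  induction l with
  | nil => simp [eulerProd]
  | cons p l ih =>
    simp only [eulerProd, List.map_cons, List.prod_cons] at ih ⊢
    rw [mul_assoc, ih, ← mul_assoc, h, mul_assoc]

theorem euler_sub_mem {d n : ℕ} (A : Matrix (Fin d) (Fin n) ℤ) (β : Fin d → ℂ) (i : Fin d) :
    euler A i - algebraMap ℂ (WeylAlgebra n) (β i) ∈ hyperIdeal A β :=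
  Ideal.subset_span (Or.inr ⟨i, rfl⟩)

/-- `b(E + s) ≡ b(β + s)` modulo `H_A(β)`. -/
theorem eulerProd_sub_mem {d n : ℕ} (A : Matrix (Fin d) (Fin n) ℤ)
    (l : List ((Fin d → ℤ) × ℕ)) (s β : Fin d → ℂ) :
    eulerProd A l s - algebraMap ℂ (WeylAlgebra n) (scalarProd l (β + s)) ∈ hyperIdeal A β := by
  have h (p : (Fin d → ℤ) × ℕ) : eulerFactor A s p -
      algebraMap ℂ (WeylAlgebra n) (linForm p.1 (β + s) - p.2) ∈ hyperIdeal A β := by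
    have e : eulerFactor A s p - algebraMap ℂ (WeylAlgebra n) (linForm p.1 (β + s) - p.2) =
        ∑ i, algebraMap ℂ _ (p.1 i : ℂ) * (euler A i - algebraMap ℂ (WeylAlgebra n) (β i)) := by
      simp only [mul_sub, Finset.sum_sub_distrib, ← map_mul, ← map_sum]
      rw [eulerFactor, linForm_add, linForm]
      simp only [map_add, map_sub]
      abel
    rw [e]
    exact Ideal.sum_mem _ fun i _ => Ideal.mul_mem_left _ _ (euler_sub_mem A β i)
  induction l with
  | nil => simp [eulerProd, scalarProd]
  | cons p l ih =>
    simp only [eulerProd, scalarProd, List.map_cons, List.prod_cons] at ih ⊢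
    -- Telescoping `f g - r s = f (g - s) + s (f - r)` with scalars `r`, `s`; each difference stands
    -- on the right, as a left ideal requires.
    have := add_mem (Ideal.mul_mem_left _ (eulerFactor A s p) ih)
      (Ideal.mul_mem_left _ (algebraMap ℂ (WeylAlgebra n)
        (l.map fun p => linForm p.1 (β + s) - p.2).prod) (h p))
    rw [mul_sub, mul_sub, Algebra.commutes _ (eulerFactor A s p), sub_add_sub_cancel,
      ← map_mul] at this
    rwa [mul_comm (linForm p.1 (β + s) - _)]

/-! ### The inverse of the contiguity map -/

theorem toricIdeal_le_hyperIdeal {d n : ℕ} (A : Matrix (Fin d) (Fin n) ℤ) (β : Fin d → ℂ) :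
    toricIdeal A ≤ hyperIdeal A β :=
  Ideal.span_mono Set.subset_union_left

/-- If `b` vanishes at the points of `ℕA` outside `A · u + ℕA`, then `b(E) ≡ Q ∂^u` modulo
`D · I_A` for some `Q` of degree `A · u`. -/
theorem exists_quotient {d n : ℕ} (A : Matrix (Fin d) (Fin n) ℤ) (l : List ((Fin d → ℤ) × ℕ))
    (u : Fin n → ℕ) (hl : ∀ w, (¬ ∃ z, deg A w = deg A (z + u)) →
      scalarProd l (param (deg A w)) = 0) :
    ∃ Q : WeylAlgebra n, eulerProd A l 0 - Q * delPow u ∈ toricIdeal A ∧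
      ∀ i, euler A i * Q = Q * (euler A i + algebraMap ℂ (WeylAlgebra n) (param (deg A u) i)) := by
  have hM : IsUpperSet {w | ∃ z, deg A w = deg A (z + u)} := by
    rintro w w' hle ⟨z, hz⟩
    refine ⟨z + (w' - w), ?_⟩
    rw [add_right_comm, deg_add, ← hz, ← deg_add, add_tsub_cancel_of_le hle]
  obtain ⟨c, hc, hcM⟩ := (hasNewtonExpansion_eulerProd A l).exists_support_subset hM hl
  choose! z hz using hcM
  -- Each `∂^v` is replaced by `∂^{z(v)} ∂^u`, and the last factor is split off.
  refine ⟨∑ v ∈ c.support, c v • (coordPow v * delPow (z v)), ?_, fun i => ?_⟩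
  · rw [hc, Finsupp.sum, Finset.sum_mul, ← Finset.sum_sub_distrib]
    refine Ideal.sum_mem _ fun v hv => ?_
    rw [smul_mul_assoc, mul_assoc, ← delPow_add, ← smul_sub, ← mul_sub, Algebra.smul_def]
    exact Ideal.mul_mem_left _ _ (Ideal.mul_mem_left _ _ (delPow_sub_mem_toricIdeal (hz v hv)))
  · rw [Finset.mul_sum, Finset.sum_mul]
    refine Finset.sum_congr rfl fun v hv => ?_
    rw [mul_smul_comm, euler_mul_normalMonomial, hz v hv, deg_add, smul_mul_assoc]
    simp [param]

section Inverse

variable {d n : ℕ} {A : Matrix (Fin d) (Fin n) ℤ} {l : List ((Fin d → ℤ) × ℕ)} {u : Fin n → ℕ}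
  {Q : WeylAlgebra n}

/-- After multiplication by `∂^u` on the right, `Q ∂^u` becomes `b(E)`, and `(∂^s - ∂^t) b(E) = b(E
+ A·s)(∂^s - ∂^t)` because `A·s = A·t`. -/
theorem toric_mul_quotient_mem (hQ : eulerProd A l 0 - Q * delPow u ∈ toricIdeal A)
    {s t : Fin n → ℕ} (hst : deg A s = deg A t) : (delPow s - delPow t) * Q ∈ toricIdeal A := by
  refine mem_toricIdeal_of_mul_delPow (u := u) ?_
  have h1 : (delPow s - delPow t) * eulerProd A l 0 ∈ toricIdeal A := by
    rw [sub_mul, ← eulerProd_mul_delPow, ← eulerProd_mul_delPow, hst, ← mul_sub]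
    exact Ideal.mul_mem_left _ _ (delPow_sub_mem_toricIdeal hst)
  have := sub_mem h1 (Ideal.mul_mem_left _ (delPow s - delPow t) hQ)
  rwa [mul_sub, sub_sub_cancel, ← mul_assoc] at this

/-- Cancel `∂^u` on the right in `∂^u Q ∂^u ≡ ∂^u b(E) = b(E + A·u) ∂^u`. -/
theorem delPow_mul_quotient_sub_mem (hQ : eulerProd A l 0 - Q * delPow u ∈ toricIdeal A) :
    eulerProd A l (param (deg A u)) - delPow u * Q ∈ toricIdeal A := by
  refine mem_toricIdeal_of_mul_delPow (u := u) ?_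
  have h := eulerProd_mul_delPow A l 0 u
  rw [zero_add] at h
  rw [sub_mul, h, mul_assoc, ← mul_sub]
  exact Ideal.mul_mem_left _ _ hQ

/-- Right multiplication by `Q` sends `H_A(β)` into `H_A(β - A · u)`. -/
theorem mul_quotient_mem (hQ : eulerProd A l 0 - Q * delPow u ∈ toricIdeal A)
    (hE : ∀ i, euler A i * Q =
      Q * (euler A i + algebraMap ℂ (WeylAlgebra n) (param (deg A u) i)))
    {β : Fin d → ℂ} {P : WeylAlgebra n} (hP : P ∈ hyperIdeal A β) :
    P * Q ∈ hyperIdeal A (β - param (deg A u)) := by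
  induction hP using Submodule.span_induction with
  | mem P hP =>
    rcases hP with ⟨s, t, hst, rfl⟩ | ⟨i, rfl⟩
    · exact toricIdeal_le_hyperIdeal A _ (toric_mul_quotient_mem hQ hst)
    · have e : (euler A i - algebraMap ℂ (WeylAlgebra n) (β i)) * Q =
          Q * (euler A i - algebraMap ℂ (WeylAlgebra n) ((β - param (deg A u)) i)) := by
        rw [sub_mul, hE, Algebra.commutes, ← mul_sub, Pi.sub_apply, map_sub]
        congr 1
        abel
      rw [e]
      exact Ideal.mul_mem_left _ _ (euler_sub_mem A _ i)
  | zero => simp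
  | add P P' _ _ h h' => rw [add_mul]; exact add_mem h h'
  | smul a P _ h => rw [smul_eq_mul, mul_assoc]; exact Ideal.mul_mem_left _ _ h

theorem bijective_contiguityMap_of_scalarProd_ne_zero {β : Fin d → ℂ}
    (hl : ∀ w, (¬ ∃ z, deg A w = deg A (z + u)) → scalarProd l (param (deg A w)) = 0)
    (hβ : scalarProd l β ≠ 0) : Function.Bijective (contiguityMap A β u) := by
  obtain ⟨Q, hQ, hE⟩ := exists_quotient A l u hl
  have cancel {γ : Fin d → ℂ} {P : WeylAlgebra n}
      (h : P * algebraMap ℂ (WeylAlgebra n) (scalarProd l β) ∈ hyperIdeal A γ) :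
      P ∈ hyperIdeal A γ := by
    have := Ideal.mul_mem_left _ (algebraMap ℂ (WeylAlgebra n) (scalarProd l β)⁻¹) h
    rwa [← Algebra.commutes, ← mul_assoc, ← map_mul, inv_mul_cancel₀ hβ, map_one, one_mul] at this
  constructor
  · refine (injective_iff_map_eq_zero _).2 fun x hx => ?_
    obtain ⟨P, rfl⟩ := Submodule.Quotient.mk_surjective _ x
    rw [contiguityMap_mk, Submodule.Quotient.mk_eq_zero] at hx
    refine (Submodule.Quotient.mk_eq_zero _).2 (cancel ?_)
    -- Modulo `H_A(β - A·u)`, `P ∂^u Q ≡ 0`, while `∂^u Q ≡ b(E + A·u) ≡ b(β)`; hence `P b(β) ≡ 0`.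
    have h1 := mul_quotient_mem hQ hE hx
    have h2 := toricIdeal_le_hyperIdeal A (β - param (deg A u)) (delPow_mul_quotient_sub_mem hQ)
    have h3 := eulerProd_sub_mem A l (param (deg A u)) (β - param (deg A u))
    rw [sub_add_cancel] at h3
    have h4 := sub_mem (Ideal.mul_mem_left _ P h2) (Ideal.mul_mem_left _ P h3)
    rw [← mul_sub, sub_sub_sub_cancel_left, mul_sub, ← mul_assoc] at h4
    simpa using add_mem h4 h1
  · intro y
    obtain ⟨P, rfl⟩ := Submodule.Quotient.mk_surjective _ y
    -- `P b(β)⁻¹ Q` is a preimage of `P`, since `Q ∂^u ≡ b(E) ≡ b(β)` modulo `H_A(β)`.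
    refine ⟨Submodule.Quotient.mk
      (P * algebraMap ℂ (WeylAlgebra n) (scalarProd l β)⁻¹ * Q), ?_⟩
    rw [contiguityMap_mk, mul_assoc _ Q]
    refine (Submodule.Quotient.eq _).2 ?_
    have h1 := toricIdeal_le_hyperIdeal A β hQ
    have h2 := eulerProd_sub_mem A l 0 β
    rw [add_zero] at h2
    have h3 := Ideal.mul_mem_left _ (P * algebraMap ℂ (WeylAlgebra n) (scalarProd l β)⁻¹)
      (sub_mem h2 h1)
    rwa [sub_sub_sub_cancel_left, mul_sub, mul_assoc P, mul_assoc P, ← map_mul,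
      inv_mul_cancel₀ hβ, map_one, mul_one, ← mul_assoc] at h3

end Inverse

/-! ### The semigroup -/

theorem mem_semigroup_iff {d n : ℕ} (A : Matrix (Fin d) (Fin n) ℤ) (w : Fin d → ℤ) :
    w ∈ semigroup A ↔ ∃ z, deg A z = w := by
  constructor
  · intro h
    induction h using AddSubmonoid.closure_induction with
    | mem w hw => obtain ⟨k, rfl⟩ := hw; exact ⟨_, deg_single A k⟩
    | zero => exact ⟨0, deg_zero A⟩
    | add w w' _ _ h h' =>
      obtain ⟨z, rfl⟩ := h
      obtain ⟨z', rfl⟩ := h'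
      exact ⟨z + z', deg_add A z z'⟩
  · rintro ⟨z, rfl⟩
    induction z using monomial_induction with
    | zero => rw [deg_zero]; exact zero_mem _
    | add z k ih =>
      rw [deg_add, deg_single]
      exact add_mem ih (AddSubmonoid.subset_closure ⟨k, rfl⟩)

theorem deg_mem_semigroup {d n : ℕ} (A : Matrix (Fin d) (Fin n) ℤ) (w : Fin n → ℕ) :
    deg A w ∈ semigroup A := (mem_semigroup_iff A _).2 ⟨w, rfl⟩

theorem semigroup_le_lattice {d n : ℕ} (A : Matrix (Fin d) (Fin n) ℤ) {w : Fin d → ℤ}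
    (h : w ∈ semigroup A) : w ∈ lattice A :=
  AddSubgroup.le_closure_toAddSubmonoid _ h

/-- The integer value `F(w)`. -/
def intPairing {d : ℕ} (F w : Fin d → ℤ) : ℤ := ∑ i, F i * w i

theorem intPairing_sub {d : ℕ} (F w w' : Fin d → ℤ) :
    intPairing F (w - w') = intPairing F w - intPairing F w' := by
  simp [intPairing, mul_sub, Finset.sum_sub_distrib]

/-- A functional that is nonnegative, but not identically zero, on `ℕA` is positive on the
interior. -/
theorem intPairing_pos_of_mem_interiorPoints {d n : ℕ} {A : Matrix (Fin d) (Fin n) ℤ}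
    {F b w : Fin d → ℤ} (hF : ∀ w ∈ semigroup A, 0 ≤ intPairing F w) (hw : w ∈ semigroup A)
    (hFw : intPairing F w ≠ 0) (hb : b ∈ interiorPoints A) : 0 < intPairing F b := by
  refine (hF b hb.1).lt_of_ne' fun h0 => ?_
  let φ : (Fin d → ℝ) →ₗ[ℝ] ℝ := ∑ i, (F i : ℝ) • LinearMap.proj i
  have hφ (w : Fin d → ℤ) : (φ fun i => (w i : ℝ)) = intPairing F w := by
    simp [φ, intPairing]
  -- The zero locus of `F` would be a face through `b`, proper because it misses `w`.
  refine hb.2 {w | w ∈ semigroup A ∧ (φ fun i => (w i : ℝ)) = 0}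
    ⟨φ, fun w hw => ?_, rfl⟩ (fun h => ?_) ⟨hb.1, ?_⟩
  · rw [hφ]; exact_mod_cast hF w hw
  · have : w ∈ {w | w ∈ semigroup A ∧ (φ fun i => (w i : ℝ)) = 0} := h ▸ hw
    exact hFw (by exact_mod_cast (hφ w).symm.trans this.2)
  · rw [hφ, h0, Int.cast_zero]

/-- A `b`-polynomial: it vanishes at the points of `ℕA` outside `A · u + ℕA`, but not at `-b` for
interior points `b`. -/
theorem exists_bPolynomial {d n : ℕ} {A : Matrix (Fin d) (Fin n) ℤ} (hA : IsSaturated A)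
    (u : Fin n → ℕ) : ∃ l : List ((Fin d → ℤ) × ℕ),
      (∀ w, (¬ ∃ z, deg A w = deg A (z + u)) → scalarProd l (param (deg A w)) = 0) ∧
      ∀ b ∈ interiorPoints A, scalarProd l (-param b) ≠ 0 := by
  classical
  obtain ⟨S, hS⟩ := exists_functionals A
  have hpair (F w : Fin d → ℤ) : pairing F (fun i => (w i : ℝ)) = intPairing F w :=
    pairing_intCast F w
  have hnonneg : ∀ F ∈ S, ∀ w ∈ semigroup A, 0 ≤ intPairing F w := fun F hF w hw => by
    have := (hS _).2 ((hA w).2 hw).2 F hF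
    rw [hpair] at this
    exact_mod_cast this
  -- Functionals vanishing on all of `ℕA` are dropped: they are not positive at interior points.
  let T := S.filter fun F => ∃ w ∈ semigroup A, intPairing F w ≠ 0
  refine ⟨T.toList.flatMap fun F =>
    (List.range (intPairing F (deg A u)).toNat).map fun m => (F, m), fun w hw => ?_, fun b hb => ?_⟩
  · have hnot : deg A w - deg A u ∉ semigroup A := fun h => by
      obtain ⟨z, hz⟩ := (mem_semigroup_iff A _).1 h
      exact hw ⟨z, by rw [deg_add, hz, sub_add_cancel]⟩
    have hlat : deg A w - deg A u ∈ lattice A :=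
      sub_mem (semigroup_le_lattice A (deg_mem_semigroup A w))
        (semigroup_le_lattice A (deg_mem_semigroup A u))
    -- By saturation `A·w - A·u` lies outside the cone, so some `F` has `0 ≤ F(A·w) < F(A·u)`, and
    -- the factor with `m = F(A·w)` vanishes.
    have hcone : ¬ _ := fun h => hnot ((hA _).1 ⟨hlat, h⟩)
    rw [← hS] at hcone
    push Not at hcone
    obtain ⟨F, hF, hneg⟩ := hcone
    rw [hpair, intPairing_sub] at hneg
    have hneg : intPairing F (deg A w) - intPairing F (deg A u) < 0 := by exact_mod_cast hneg
    have h0 := hnonneg F hF _ (deg_mem_semigroup A w)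
    refine List.prod_eq_zero (List.mem_map.2
      ⟨(F, (intPairing F (deg A w)).toNat), List.mem_flatMap.2 ⟨F, ?_, ?_⟩, ?_⟩)
    · exact Finset.mem_toList.2 (Finset.mem_filter.2
        ⟨hF, _, deg_mem_semigroup A u, by omega⟩)
    · exact List.mem_map.2 ⟨_, List.mem_range.2 (by omega), rfl⟩
    · have : (((intPairing F (deg A w)).toNat : ℤ) : ℂ) = (intPairing F (deg A w) : ℂ) := by
        rw [Int.toNat_of_nonneg h0]
      rw [linForm_param, sub_eq_zero]
      exact this.symm
  · refine List.prod_ne_zero fun h => ?_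
    obtain ⟨⟨F, m⟩, hp, h⟩ := List.mem_map.1 h
    obtain ⟨F', hF', hp⟩ := List.mem_flatMap.1 hp
    obtain ⟨m', -, hp⟩ := List.mem_map.1 hp
    obtain ⟨rfl, rfl⟩ := Prod.mk.inj hp
    obtain ⟨hF, w, hw, hFw⟩ := Finset.mem_filter.1 (Finset.mem_toList.1 hF')
    have hpos := intPairing_pos_of_mem_interiorPoints (hnonneg _ hF) hw hFw hb
    have h1 : linForm F' (-param b) = ((-intPairing F' b : ℤ) : ℂ) := by
      simp [linForm, param, intPairing]
    rw [h1] at h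
    have h2 : -intPairing F' b - (m' : ℤ) = 0 := by exact_mod_cast h
    omega

/-! ### Isomorphisms at interior parameters and submodules of `M_A^0` -/

theorem bijective_contiguityMap {d n : ℕ} {A : Matrix (Fin d) (Fin n) ℤ} (hA : IsSaturated A)
    (u : Fin n → ℕ) {b : Fin d → ℤ} (hb : b ∈ interiorPoints A) :
    Function.Bijective (contiguityMap A (-param b) u) := by
  obtain ⟨l, hl, hl'⟩ := exists_bPolynomial hA u
  exact bijective_contiguityMap_of_scalarProd_ne_zero hl (hl' b hb)

theorem monomialSubmodule_eq_range {d n : ℕ} (A : Matrix (Fin d) (Fin n) ℤ) (v : Fin n → ℕ) :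
    monomialSubmodule A v = LinearMap.range (contiguityMap A 0 v) := by
  ext y
  rw [monomialSubmodule, Submodule.mem_span_singleton, LinearMap.mem_range]
  constructor
  · rintro ⟨P, rfl⟩
    exact ⟨Submodule.Quotient.mk P, rfl⟩
  · rintro ⟨x, rfl⟩
    obtain ⟨P, rfl⟩ := Submodule.Quotient.mk_surjective _ x
    exact ⟨P, rfl⟩

theorem monomialSubmodule_add {d n : ℕ} {A : Matrix (Fin d) (Fin n) ℤ} (hA : IsSaturated A)
    (u : Fin n → ℕ) {v : Fin n → ℕ} (hv : deg A v ∈ interiorPoints A) :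
    monomialSubmodule A (u + v) = monomialSubmodule A v := by
  refine le_antisymm ((Submodule.span_singleton_le_iff_mem _ _).2 ?_)
    ((Submodule.span_singleton_le_iff_mem _ _).2 ?_)
  · refine Submodule.mem_span_singleton.2 ⟨delPow u, ?_⟩
    rw [delPow_add]; rfl
  · obtain ⟨x, hx⟩ := (bijective_contiguityMap hA u hv).2 (Submodule.Quotient.mk 1)
    obtain ⟨P, rfl⟩ := Submodule.Quotient.mk_surjective _ x
    rw [contiguityMap_mk] at hx
    have h1 := (Submodule.Quotient.eq _).1 hx
    rw [← zero_sub] at h1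
    have h2 : (P * delPow u - 1) * delPow v ∈ hyperIdeal A 0 := hyperIdeal_le_comap A 0 v h1
    refine Submodule.mem_span_singleton.2 ⟨P, (Submodule.Quotient.eq _).2 ?_⟩
    change P * delPow (u + v) - delPow v ∈ _
    rwa [sub_mul, one_mul, mul_assoc, ← delPow_add] at h2

end GKZ

theorem mainTheorem10 {d n : ℕ} (A : Matrix (Fin d) (Fin n) ℤ)
    (hpointed : GKZ.IsPointed A) (hsaturated : GKZ.IsSaturated A) :
    (∀ u v : Fin n → ℕ, GKZ.deg A v ∈ GKZ.interiorPoints A →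
      Function.Bijective (GKZ.contiguityMap A (-GKZ.param (GKZ.deg A v)) u)) ∧
    (∀ v : Fin n → ℕ, GKZ.deg A v ∈ GKZ.interiorPoints A →
      GKZ.monomialSubmodule A v = LinearMap.range (GKZ.contiguityMap A 0 v)) ∧
    (∀ v v' : Fin n → ℕ, GKZ.deg A v ∈ GKZ.interiorPoints A →
      GKZ.deg A v' ∈ GKZ.interiorPoints A →
      GKZ.monomialSubmodule A v = GKZ.monomialSubmodule A v') := by
  refine ⟨fun u v hv => GKZ.bijective_contiguityMap hsaturated u hv,
    fun v _ => GKZ.monomialSubmodule_eq_range A v, fun v v' hv hv' => ?_⟩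
  -- Both submodules equal the one generated by `∂^{v+v'}`.
  rw [← GKZ.monomialSubmodule_add hsaturated v' hv, add_comm,
    GKZ.monomialSubmodule_add hsaturated v hv']
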